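/- **Theorem 1.** Let $G$ be a torsion-free nilpotent group of class $2$ (class at most $2$ is allowed). Call a group $H$ together with an embedding $G\hookrightarrow H$ a *Mal'tsev completion* $\sqrt G$ of $G$ if for every $n\ge 1$ every element of $H$ has exactly one $n$-th root in $H$, and $H$ is minimal with this property over $G$, i.e. no proper subgroup of $H$ containing $G$ contains an $n$-th root of each of its elements for all $n\ge 1$. Then: 1. $G$ has a Mal'tsev completion. 2. $G$ is geometrically equivalent to its Mal'tsev completion $\sqrt G$. That is, for every variety of groups $\Theta$ with $G\in\Theta$ one has $\sqrt G\in\Theta$, and for every finite set $X$ and every subset $T$ of the free group $W(X)$ of the variety $\Theta$ over $X$, $$T''_G=T''_{\sqrt G},\qquad\text{where}\quad T'_K=\{\mu\in\mathrm{Hom}(W(X),K)\mid T\subseteq\ker\mu\},\quad T''_K=\bigcap_{\mu\in T'_K}\ker\mu .$$ 3. Consequently $G$ and $\sqrt G$ have the same quasi-identities: for all group words $t_1,\dots,t_m,w$, the implication $t_1=1\wedge\dots\wedge t_m=1\Rightarrow w=1$ holds for all values of the variables in $G$ if and only if it does for all values of the variables in $\sqrt G$. -/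

import Mathlib

/-- A variety of groups, given by a set of laws `w = 1` in countably many variables. -/
structure GroupVariety where
  /-- The words that are required to vanish identically. -/
  laws : Set (FreeGroup ℕ)

namespace GroupVariety

/-- The group `G` belongs to the variety `Θ`: all laws of `Θ` hold in `G`. -/
def Contains (Θ : GroupVariety) (G : Type*) [Group G] : Prop :=
  ∀ w ∈ Θ.laws, ∀ f : FreeGroup ℕ →* G, f w = 1

/-- The verbal subgroup of the absolutely free group on `X` that belongs to `Θ`: it is generated,
as a normal subgroup, by all values of the laws of `Θ`. -/
def verbalSubgroup (Θ : GroupVariety) (X : Type) : Subgroup (FreeGroup X) :=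
  Subgroup.normalClosure {v | ∃ w ∈ Θ.laws, ∃ f : FreeGroup ℕ →* FreeGroup X, f w = v}

instance (Θ : GroupVariety) (X : Type) : (Θ.verbalSubgroup X).Normal :=
  Subgroup.normalClosure_normal

/-- The free group `W(X)` of the variety `Θ` over the set `X`. -/
abbrev W (Θ : GroupVariety) (X : Type) : Type := FreeGroup X ⧸ Θ.verbalSubgroup X

/-- The algebraic variety `T'_G` of `T ⊆ W(X)` in the affine space `Hom(W(X), G)`. -/
def algVariety (Θ : GroupVariety) {X : Type} (G : Type*) [Group G] (T : Set (Θ.W X)) :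
    Set (Θ.W X →* G) :=
  {μ | T ⊆ (μ.ker : Set (Θ.W X))}

/-- The `G`-closure `T''_G` of `T ⊆ W(X)`. -/
def geomClosure (Θ : GroupVariety) {X : Type} (G : Type*) [Group G] (T : Set (Θ.W X)) :
    Set (Θ.W X) :=
  ⋂ μ ∈ Θ.algVariety G T, (μ.ker : Set (Θ.W X))

/-- `X`-equivalence of two groups, relative to the variety `Θ`. -/
def XEquivalent (Θ : GroupVariety) (X : Type) (G H : Type*) [Group G] [Group H] : Prop :=
  ∀ T : Set (Θ.W X), Θ.geomClosure G T = Θ.geomClosure H T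

/-- Geometrical equivalence of two groups of the variety `Θ`. -/
structure GeomEquivalent (Θ : GroupVariety) (G H : Type*) [Group G] [Group H] : Prop where
  left_mem : Θ.Contains G
  right_mem : Θ.Contains H
  xEquivalent : ∀ (X : Type) [Finite X], Θ.XEquivalent X G H

end GroupVariety

/-- The quasi-identity `t = 1 for all t in T implies w = 1` holds in `G`. -/
def SatisfiesQuasiIdentity (G : Type*) [Group G] (T : Finset (FreeGroup ℕ)) (w : FreeGroup ℕ) :
    Prop :=
  ∀ f : FreeGroup ℕ →* G, (∀ t ∈ T, f t = 1) → f w = 1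

/-- The same quasi-identities hold in `G` and in `H`. -/
def SameQuasiIdentities (G H : Type*) [Group G] [Group H] : Prop :=
  ∀ (T : Finset (FreeGroup ℕ)) (w : FreeGroup ℕ),
    SatisfiesQuasiIdentity G T w ↔ SatisfiesQuasiIdentity H T w

/-- The embedding `i : G → H` makes `H` a Mal'tsev completion of `G`: every element of `H` has
exactly one `n`-th root for each `n ≥ 1`, and no proper subgroup of `H` that contains the image of
`G` has all roots of its elements. -/
structure IsMaltsevCompletion {G H : Type*} [Group G] [Group H] (i : G →* H) : Prop where
  injective : Function.Injective i
  existsUnique_root : ∀ n : ℕ, n ≠ 0 → ∀ x : H, ∃! y : H, y ^ n = x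
  minimal : ∀ K : Subgroup H, i.range ≤ K →
    (∀ n : ℕ, n ≠ 0 → ∀ x ∈ K, ∃ y ∈ K, y ^ n = x) → K = ⊤

universe u v

open scoped commutatorElement IsMulCommutative

/-! The key is a quadratic map `q` into a divisible abelian group receiving the centre: q(xy) =
q(x)q(y)[x,y], and q(z) = z² for central z (`exists_quadratic_map`). In class two, powers fail to be
multiplicative only by (xy)^n [x,y]^(n choose 2) = x^n y^n. Taking `q` on √G with values in its
centre, x ↦ x^(2m) q(x)^(2m choose 2) is therefore an endomorphism; it is z ↦ z^(4m²) on the centre,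
hence injective. Every element of √G has a power in G, so a suitable m moves any finite set into G
(`exists_injective_endomorphism`). Composing with this map turns a homomorphism from a finitely
generated group to √G into one to G with the same kernel; for laws and quasi-identities, only the
finitely many variables that occur matter. For existence, the same `q` embeds G into a
Heisenberg-type group with unique roots (`exists_injective_hom_hasUniqueRoots`), where the smallest
isolated subgroup over G is a completion. -/

/-- Every element has exactly one `n`-th root, for every `n ≠ 0`. -/
def HasUniqueRoots (H : Type*) [Group H] : Prop :=
  ∀ n : ℕ, n ≠ 0 → Function.Bijective fun x : H => x ^ n

theorem HasUniqueRoots.isMulTorsionFree {H : Type*} [Group H] (h : HasUniqueRoots H) :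
    IsMulTorsionFree H :=
  ⟨fun n hn => (h n hn).1⟩

theorem HasUniqueRoots.monoidHom {A D : Type*} [Group A] [CommGroup D] (h : HasUniqueRoots D) :
    HasUniqueRoots (A →* D) := by
  intro n hn
  refine ⟨fun f g hfg => MonoidHom.ext fun x => (h n hn).1 (DFunLike.congr_fun hfg x), fun f => ?_⟩
  choose r hr using (h n hn).2
  refine ⟨MonoidHom.mk' (fun x => r (f x)) fun x y => (h n hn).1 ?_, MonoidHom.ext fun x => hr _⟩
  simp only [mul_pow, map_mul] at hr ⊢
  rw [hr, hr, hr]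

theorem HasUniqueRoots.prod {A B : Type*} [Group A] [Group B] (hA : HasUniqueRoots A)
    (hB : HasUniqueRoots B) : HasUniqueRoots (A × B) := fun n hn =>
  (hA n hn).prodMap (hB n hn)

/-- The central extension of `A` by `D` whose cocycle is the bimultiplicative map `β`. -/
@[ext]
structure TwistedProd {A D : Type*} [Group A] [CommGroup D] (β : A →* A →* D) where
  /-- The component in the quotient. -/
  fst : A
  /-- The component in the central subgroup. -/
  snd : D

/-! ### Central extensions by a bimultiplicative cocycle -/

namespace TwistedProd

variable {A D : Type*} [Group A] [CommGroup D] {β : A →* A →* D}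

instance : Mul (TwistedProd β) := ⟨fun x y => ⟨x.fst * y.fst, x.snd * y.snd * β x.fst y.fst⟩⟩
instance : One (TwistedProd β) := ⟨⟨1, 1⟩⟩
instance : Inv (TwistedProd β) := ⟨fun x => ⟨x.fst⁻¹, x.snd⁻¹ * β x.fst x.fst⟩⟩

@[simp] theorem fst_mul (x y : TwistedProd β) : (x * y).fst = x.fst * y.fst := rfl
@[simp] theorem snd_mul (x y : TwistedProd β) :
    (x * y).snd = x.snd * y.snd * β x.fst y.fst := rfl
@[simp] theorem fst_one : (1 : TwistedProd β).fst = 1 := rfl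
@[simp] theorem snd_one : (1 : TwistedProd β).snd = 1 := rfl
@[simp] theorem fst_inv (x : TwistedProd β) : x⁻¹.fst = x.fst⁻¹ := rfl
@[simp] theorem snd_inv (x : TwistedProd β) : x⁻¹.snd = x.snd⁻¹ * β x.fst x.fst := rfl

instance : Group (TwistedProd β) :=
  Group.ofLeftAxioms
    (fun x y z => by
      ext
      · simp [mul_assoc]
      · have h : β (x.fst * y.fst) z.fst = β x.fst z.fst * β y.fst z.fst := by rw [map_mul]; rfl
        rw [snd_mul, snd_mul, snd_mul, snd_mul, fst_mul, fst_mul, h, map_mul]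
        ac_rfl)
    (fun x => by ext <;> simp)
    (fun x => by
      ext
      · simp
      · simp only [snd_mul, snd_inv, fst_inv, map_inv, MonoidHom.inv_apply, snd_one]
        rw [mul_right_comm, mul_assoc, mul_assoc]; simp)

@[simp] theorem fst_pow (x : TwistedProd β) (n : ℕ) : (x ^ n).fst = x.fst ^ n := by
  induction n with
  | zero => simp
  | succ n ih => simp [pow_succ, ih]

theorem snd_pow (x : TwistedProd β) (n : ℕ) :
    (x ^ n).snd = x.snd ^ n * β x.fst x.fst ^ n.choose 2 := by
  induction n with
  | zero => simp
  | succ n ih =>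
    have h : β (x.fst ^ n) x.fst = β x.fst x.fst ^ n := by rw [map_pow]; rfl
    rw [pow_succ, snd_mul, ih, fst_pow, h, Nat.choose_succ_succ', Nat.choose_one_right,
      pow_add (β x.fst x.fst), pow_succ x.snd]
    ac_rfl

/-- The root in `A` is forced, and the cocycle correction in `snd_pow` depends on it alone, so what
remains is a root in `D`. -/
theorem hasUniqueRoots (hA : HasUniqueRoots A) (hD : HasUniqueRoots D) :
    HasUniqueRoots (TwistedProd β) := by
  intro n hn
  refine ⟨fun x y hxy => ?_, fun x => ?_⟩
  · have h1 : x.fst = y.fst := (hA n hn).1 (by simpa using congrArg fst hxy)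
    have h2 := congrArg snd hxy
    simp only [snd_pow, h1, mul_left_inj] at h2
    exact TwistedProd.ext h1 ((hD n hn).1 h2)
  · obtain ⟨a, ha⟩ := (hA n hn).2 x.fst
    obtain ⟨d, hd⟩ := (hD n hn).2 (x.snd * (β a a ^ n.choose 2)⁻¹)
    refine ⟨⟨a, d⟩, TwistedProd.ext (by simpa using ha) ?_⟩
    simp only at hd
    simp [snd_pow, hd]

end TwistedProd

/-! ### Divisible abelian groups -/

section Divisible

variable {D : Type*} [CommGroup D]

theorem exists_extension_of_divisible (hD : ∀ n : ℕ, n ≠ 0 → ∀ x : D, ∃ y : D, y ^ n = x)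
    {L : Type*} [CommGroup L] (f : D →* L) (hf : Function.Injective f) :
    ∃ r : L →* D, ∀ x, r (f x) = x := by
  classical
  let _ : DivisibleBy (Additive D) ℕ := divisibleByOfSMulRightSurj _ _ fun {n} hn x => by
    obtain ⟨y, hy⟩ := hD n hn x.toMul
    exact ⟨Additive.ofMul y, congrArg Additive.ofMul hy⟩
  let _ : DivisibleBy (Additive D) ℤ := AddGroup.divisibleByIntOfDivisibleByNat _
  obtain ⟨h, hh⟩ := (Module.Baer.of_divisible (Additive D)).extension_property_addMonoidHom
    (MonoidHom.toAdditive f) hf (AddMonoidHom.id _)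
  exact ⟨MonoidHom.toAdditive.symm h, fun x => DFunLike.congr_fun hh (Additive.ofMul x)⟩

end Divisible

/-- Tensor with ℚ: a torsion-free abelian group is flat over ℤ, so ℤ → ℚ stays injective. -/
theorem exists_embedding_hasUniqueRoots (A : Type u) [CommGroup A] [IsMulTorsionFree A] :
    ∃ (D : Type u) (_ : CommGroup D) (f : A →* D), HasUniqueRoots D ∧ Function.Injective f := by
  have hinj : Function.Injective
      ((Algebra.linearMap ℤ ℚ).rTensor (Additive A)) :=
    Module.Flat.rTensor_preserves_injective_linearMap _ (by
      intro a b h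
      simpa using h)
  let f : Additive A →+ TensorProduct ℤ ℚ (Additive A) :=
    ((Algebra.linearMap ℤ ℚ).rTensor (Additive A) ∘ₗ
      (TensorProduct.lid ℤ (Additive A)).symm.toLinearMap).toAddMonoidHom
  refine ⟨Multiplicative (TensorProduct ℤ ℚ (Additive A)), inferInstance,
    AddMonoidHom.toMultiplicativeRight f, ?_, ?_⟩
  · intro n hn
    have hn' : (n : ℚ) ≠ 0 := by exact_mod_cast hn
    refine ⟨fun x y h => ?_, fun x =>
      ⟨Multiplicative.ofAdd ((n : ℚ)⁻¹ • Multiplicative.toAdd x), ?_⟩⟩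
    · have h' : n • Multiplicative.toAdd x = n • Multiplicative.toAdd y := h
      rw [← Nat.cast_smul_eq_nsmul ℚ, ← Nat.cast_smul_eq_nsmul ℚ] at h'
      exact smul_right_injective (TensorProduct ℤ ℚ (Additive A)) hn' h'
    · change Multiplicative.ofAdd (n • ((n : ℚ)⁻¹ • Multiplicative.toAdd x)) = x
      rw [← Nat.cast_smul_eq_nsmul ℚ, smul_inv_smul₀ hn', ofAdd_toAdd]
  · exact hinj.comp (TensorProduct.lid ℤ (Additive A)).symm.injective

/-! ### Commutators and the quadratic map in class two -/

section ClassTwo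

variable {G : Type*} [Group G]

/-- The commutator map of a group of class two, as a bimultiplicative map into the center. -/
def commutatorHom (hc : ∀ x y : G, ⁅x, y⁆ ∈ Subgroup.center G) :
    G →* G →* Subgroup.center G :=
  MonoidHom.mk' (fun x => MonoidHom.mk' (fun y => ⟨⁅x, y⁆, hc x y⟩) fun y z => by
      refine Subtype.ext ?_
      have h := Subgroup.mem_center_iff.1 (hc x z) y
      simp only [commutatorElement_def, Subgroup.coe_mul] at h ⊢
      calc x * (y * z) * x⁻¹ * (y * z)⁻¹ = x * y * x⁻¹ * (x * z * x⁻¹ * z⁻¹) * y⁻¹ := by group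
        _ = x * y * x⁻¹ * y⁻¹ * (y * (x * z * x⁻¹ * z⁻¹)) * y⁻¹ := by group
        _ = _ := by rw [h]; group)
    fun x y => by
      ext z
      have h := Subgroup.mem_center_iff.1 (hc y z) x
      simp only [MonoidHom.mk'_apply, MonoidHom.mul_apply, commutatorElement_def,
        Subgroup.coe_mul] at h ⊢
      have h' := Subgroup.mem_center_iff.1 (hc y z) (x * z * x⁻¹ * z⁻¹)
      rw [commutatorElement_def] at h'
      calc x * y * z * (x * y)⁻¹ * z⁻¹ = x * (y * z * y⁻¹ * z⁻¹) * z * x⁻¹ * z⁻¹ := by group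
        _ = _ := by rw [h, h']; group

@[simp] theorem coe_commutatorHom (hc : ∀ x y : G, ⁅x, y⁆ ∈ Subgroup.center G) (x y : G) :
    (commutatorHom hc x y : G) = ⁅x, y⁆ := rfl

theorem mul_pow_of_commutator_mem_center (hc : ∀ x y : G, ⁅x, y⁆ ∈ Subgroup.center G)
    (x y : G) (n : ℕ) : (x * y) ^ n * ⁅x, y⁆ ^ n.choose 2 = x ^ n * y ^ n := by
  have hz : ∀ (k : ℕ) (w : G), Commute (⁅x, y⁆ ^ k) w := fun k w =>
    Commute.pow_left (Subgroup.mem_center_iff.1 (hc x y) w).symm k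
  have hcomm : ∀ n : ℕ, y ^ n * x * ⁅x, y⁆ ^ n = x * y ^ n := fun n => by
    have h : ⁅x, y ^ n⁆ = ⁅x, y⁆ ^ n := by
      exact congrArg Subtype.val (map_pow (commutatorHom hc x) y n)
    rw [← (hz n _).eq, ← h, commutatorElement_def]
    group
  induction n with
  | zero => simp
  | succ n ih =>
    calc (x * y) ^ (n + 1) * ⁅x, y⁆ ^ (n + 1).choose 2
        = (x * y) ^ n * ⁅x, y⁆ ^ n.choose 2 * (x * ⁅x, y⁆ ^ n) * y := by
          have h : ⁅x, y⁆ ^ n.choose 2 * (x * ⁅x, y⁆ ^ n) * y =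
              x * y * (⁅x, y⁆ ^ (n + n.choose 2)) := by
            rw [← mul_assoc, (hz _ x).eq, mul_assoc x, ← pow_add, mul_assoc, (hz _ y).eq, mul_assoc,
              add_comm]
          rw [Nat.choose_succ_succ', Nat.choose_one_right, pow_succ, mul_assoc _ (x * y), ← h]
          simp only [mul_assoc]
      _ = x ^ n * (y ^ n * x * ⁅x, y⁆ ^ n) * y := by rw [ih]; simp only [mul_assoc]
      _ = x ^ (n + 1) * y ^ (n + 1) := by rw [hcomm, pow_succ x, pow_succ y]; simp only [mul_assoc]

/-- Twisting G × D by [x,y]⁻¹ gives the commutators ([x,y], [x,y]⁻²). Dividing out the central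
elements (z, z⁻²) makes the group abelian while D still embeds; divisibility gives a retraction onto
D, and `q` is its value on (x, 1). -/
theorem exists_quadratic_map (hc : ∀ x y : G, ⁅x, y⁆ ∈ Subgroup.center G)
    {D : Type*} [CommGroup D] (hD : ∀ n : ℕ, n ≠ 0 → ∀ x : D, ∃ y : D, y ^ n = x)
    (ι : Subgroup.center G →* D) :
    ∃ q : G → D, (∀ x y, q (x * y) = q x * q y * ι (commutatorHom hc x y)) ∧
      ∀ z : Subgroup.center G, q z = ι z ^ 2 := by
  let β : G →* G →* D := (MonoidHom.compHom ι).comp (commutatorHom hc)⁻¹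
  have hβ : ∀ x y, β x y = (ι (commutatorHom hc x y))⁻¹ := fun x y => by simp [β]
  have hcz : ∀ (z : Subgroup.center G) (x : G), commutatorHom hc z x = 1 := fun z x => by
    ext
    simp [commutatorElement_eq_one_iff_mul_comm, Subgroup.mem_center_iff.1 z.2 x]
  have hzc : ∀ (z : Subgroup.center G) (x : G), commutatorHom hc x z = 1 := fun z x => by
    ext
    simp [commutatorElement_eq_one_iff_mul_comm, Subgroup.mem_center_iff.1 z.2 x]
  let ν : Subgroup.center G →* TwistedProd β := MonoidHom.mk' (fun z => ⟨z, (ι z ^ 2)⁻¹⟩)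
    fun z w => by ext <;> simp [hβ, hcz, mul_pow, mul_comm]
  have hνc : ∀ z x, x * ν z = ν z * x := fun z x => by
    ext
    · exact Subgroup.mem_center_iff.1 z.2 x.fst
    · simp [ν, hβ, hcz, hzc, mul_comm]
  let N : Subgroup (TwistedProd β) := ν.range
  have hN : N.Normal := ⟨by
    rintro _ ⟨z, rfl⟩ x
    rw [hνc, mul_inv_cancel_right]
    exact ⟨z, rfl⟩⟩
  have hcomm : ∀ x y : TwistedProd β ⧸ N, x * y = y * x := by
    rintro ⟨x⟩ ⟨y⟩
    refine ((QuotientGroup.eq (s := N)).2 (?_ : (y * x)⁻¹ * (x * y) ∈ N)).symm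
    refine ⟨commutatorHom hc x.fst y.fst, ?_⟩
    rw [eq_inv_mul_iff_mul_eq]
    have hyx : β y.fst x.fst * (ι (commutatorHom hc x.fst y.fst))⁻¹ = 1 := by
      rw [hβ, ← mul_inv, ← map_mul]
      have : commutatorHom hc y.fst x.fst * commutatorHom hc x.fst y.fst = 1 := by
        ext
        simp [commutatorElement_def, mul_assoc]
      rw [this, map_one, inv_one]
    ext
    · change y.fst * x.fst * ⁅x.fst, y.fst⁆ = x.fst * y.fst
      rw [Subgroup.mem_center_iff.1 (hc x.fst y.fst), commutatorElement_def]
      group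
    · change y.snd * x.snd * β y.fst x.fst * (ι (commutatorHom hc x.fst y.fst) ^ 2)⁻¹ *
        β (y.fst * x.fst) (commutatorHom hc x.fst y.fst) = x.snd * y.snd * β x.fst y.fst
      rw [hβ (_ * _), hzc, map_one, inv_one, mul_one, pow_two, mul_inv, mul_assoc _ (β _ _),
        ← mul_assoc (β _ _), hyx, one_mul, ← hβ, mul_comm y.snd]
  let _ : CommGroup (TwistedProd β ⧸ N) := { mul_comm := hcomm }
  let j : D →* TwistedProd β := MonoidHom.mk' (fun d => ⟨1, d⟩) fun d e => by ext <;> simp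
  obtain ⟨r, hr⟩ := exists_extension_of_divisible hD ((QuotientGroup.mk' N).comp j) (by
    rw [injective_iff_map_eq_one]
    intro d hd
    obtain ⟨z, hz⟩ := (QuotientGroup.eq_one_iff (N := N) _).1 hd
    have h1 : z = 1 := Subtype.ext (congrArg TwistedProd.fst hz)
    have h2 := congrArg TwistedProd.snd hz
    simpa [h1, ν, j] using h2.symm)
  let s : G → TwistedProd β := fun x => ⟨x, 1⟩
  refine ⟨fun x => r (QuotientGroup.mk' N (s x)), fun x y => ?_, fun z => ?_⟩
  · have h : s (x * y) = s x * s y * j (ι (commutatorHom hc x y)) := by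
      ext <;> simp [s, j, hβ]
    beta_reduce
    rw [h, map_mul, map_mul, map_mul, map_mul]
    exact congrArg _ (hr _)
  · have h : s z = ν z * j (ι z ^ 2) := by ext <;> simp [s, j, ν]
    have h1 : QuotientGroup.mk' N (ν z) = 1 := (QuotientGroup.eq_one_iff _).2 ⟨z, rfl⟩
    beta_reduce
    rw [h, map_mul, h1, one_mul]
    exact hr _

end ClassTwo

/-! ### Isolated subgroups and existence of a completion -/

/-- A subgroup that contains all roots of its elements. -/
def Subgroup.IsIsolated {H : Type*} [Group H] (K : Subgroup H) : Prop :=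
  ∀ n : ℕ, n ≠ 0 → ∀ x : H, x ^ n ∈ K → x ∈ K

theorem Subgroup.IsIsolated.comap {H L : Type*} [Group H] [Group L] {K : Subgroup L}
    (hK : K.IsIsolated) (f : H →* L) : (K.comap f).IsIsolated := fun n hn x hx =>
  hK n hn (f x) (by simpa using hx)

theorem Subgroup.isIsolated_centralizer {H : Type*} [Group H] [IsMulTorsionFree H] (S : Set H) :
    (Subgroup.centralizer S).IsIsolated := by
  intro n hn x hx
  rw [Subgroup.mem_centralizer_iff] at hx ⊢
  intro y hy
  have h : (y * x * y⁻¹) ^ n = x ^ n := by rw [conj_pow, hx y hy, mul_inv_cancel_right]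
  exact mul_inv_eq_iff_eq_mul.1 (pow_left_injective hn h)

theorem Subgroup.isIsolated_center {H : Type*} [Group H] [IsMulTorsionFree H] :
    (Subgroup.center H).IsIsolated := by
  rw [← Subgroup.centralizer_univ]
  exact Subgroup.isIsolated_centralizer _

/-- If x^n and y^n differ by a central element, its n-th root w is central, so (xw)^n = y^n and y =
xw. -/
theorem HasUniqueRoots.quotient_center {H : Type*} [Group H] (h : HasUniqueRoots H) :
    HasUniqueRoots (H ⧸ Subgroup.center H) := by
  have := h.isMulTorsionFree
  intro n hn
  refine ⟨?_, ?_⟩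
  · rintro ⟨x⟩ ⟨y⟩ hxy
    have hz : (x ^ n)⁻¹ * y ^ n ∈ Subgroup.center H := QuotientGroup.eq.1 hxy
    obtain ⟨w, hw⟩ := (h n hn).2 ((x ^ n)⁻¹ * y ^ n)
    have hwc : w ∈ Subgroup.center H := Subgroup.isIsolated_center n hn w (by simpa [hw] using hz)
    have hxw : (x * w) ^ n = y ^ n := by
      rw [(show Commute x w from Subgroup.mem_center_iff.1 hwc x).mul_pow]
      exact (congrArg _ hw).trans (mul_inv_cancel_left _ _)
    refine QuotientGroup.eq.2 ?_
    rwa [← pow_left_injective hn hxw, inv_mul_cancel_left]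
  · rintro ⟨x⟩
    obtain ⟨y, hy⟩ := (h n hn).2 x
    exact ⟨QuotientGroup.mk y, congrArg QuotientGroup.mk hy⟩

/-- A group that embeds into a group with unique roots has a Mal'tsev completion. -/
theorem HasUniqueRoots.exists_isMaltsevCompletion {G : Type*} {H : Type u} [Group G] [Group H]
    (h : HasUniqueRoots H) (f : G →* H) (hf : Function.Injective f) :
    ∃ (K : Type u) (_ : Group K) (i : G →* K), IsMaltsevCompletion i := by
  let K : Subgroup H := sInf {L | f.range ≤ L ∧ L.IsIsolated}
  have hfK : f.range ≤ K := le_sInf fun L hL => hL.1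
  have hK : K.IsIsolated := fun n hn x hx => Subgroup.mem_sInf.2 fun L hL =>
    hL.2 n hn x (Subgroup.mem_sInf.1 hx L hL)
  refine ⟨K, inferInstance, f.codRestrict K fun g => hfK ⟨g, rfl⟩, ?_, ?_, ?_⟩
  · intro x y hxy
    exact hf (congrArg Subtype.val hxy)
  · rintro n hn ⟨x, hx⟩
    obtain ⟨y, hy : y ^ n = x⟩ := (h n hn).2 x
    exact ⟨⟨y, hK n hn y (hy ▸ hx)⟩, Subtype.ext hy, fun z hz =>
      Subtype.ext ((h n hn).1 ((congrArg Subtype.val hz).trans hy.symm))⟩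
  · intro L hL hroot
    -- As roots in `H` are unique, a subgroup of `K` closed under taking roots is isolated in `H`,
    -- hence contains `K`.
    have hle : K ≤ L.map K.subtype := sInf_le ⟨?_, ?_⟩
    · refine eq_top_iff.2 fun x _ => ?_
      obtain ⟨y, hy, hyx⟩ := hle x.2
      rwa [← Subtype.ext hyx]
    · rintro _ ⟨g, rfl⟩
      exact ⟨_, hL ⟨g, rfl⟩, rfl⟩
    · rintro n hn x ⟨y, hy, hyx⟩
      obtain ⟨z, hz, hzy⟩ := hroot n hn y hy
      refine ⟨z, hz, (h n hn).1 ?_⟩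
      exact (congrArg Subtype.val hzy).trans hyx

theorem exists_injective_hom_hasUniqueRoots {G : Type u} [Group G] [IsMulTorsionFree G]
    (hc : ∀ x y : G, ⁅x, y⁆ ∈ Subgroup.center G) :
    ∃ (H : Type u) (_ : Group H) (f : G →* H), HasUniqueRoots H ∧ Function.Injective f := by
  have : IsMulTorsionFree (Subgroup.center G) :=
    ⟨fun n hn x y h => Subtype.ext (pow_left_injective hn (congrArg Subtype.val h))⟩
  obtain ⟨D, _, ι, hD, hι⟩ := exists_embedding_hasUniqueRoots (Subgroup.center G)
  obtain ⟨q, hq, hqz⟩ := exists_quadratic_map hc (fun n hn => (hD n hn).2) ι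
  -- The evaluation pairing of Hom(G, D) with its dual. The images of x and y pair to (eval y)(c x)
  -- = ι[x,y], exactly the defect of `q`.
  let β : (G →* D) × ((G →* D) →* D) →* (G →* D) × ((G →* D) →* D) →* D :=
    MonoidHom.mk' (fun a => MonoidHom.mk' (fun b => b.2 a.1) fun b b' => rfl)
      fun a a' => MonoidHom.ext fun b => map_mul b.2 a.1 a'.1
  let c : G →* G →* D := (MonoidHom.compHom ι).comp (commutatorHom hc)
  let f : G →* TwistedProd β :=
    MonoidHom.mk' (fun x => ⟨(c x, MonoidHom.eval x), q x⟩) fun x y => by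
      ext g
      · simp
      · simp
      · exact hq x y
  refine ⟨TwistedProd β, inferInstance, f,
    TwistedProd.hasUniqueRoots (hD.monoidHom.prod hD.monoidHom) hD, ?_⟩
  rw [injective_iff_map_eq_one]
  intro x hx
  have hxc : x ∈ Subgroup.center G := Subgroup.mem_center_iff.2 fun y => by
    have h : c x y = 1 := DFunLike.congr_fun (congrArg (fun t => t.fst.1) hx) y
    have h' : commutatorHom hc x y = 1 := hι (h.trans (map_one ι).symm)
    exact (commutatorElement_eq_one_iff_mul_comm.1 (congrArg Subtype.val h')).symm
  have h : ι ⟨x, hxc⟩ ^ 2 = 1 := (hqz ⟨x, hxc⟩).symm.trans (congrArg TwistedProd.snd hx)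
  have h1 : ι ⟨x, hxc⟩ = 1 := (hD 2 two_ne_zero).1 (by simpa using h)
  exact congrArg Subtype.val (hι (h1.trans (map_one ι).symm))

/-! ### Structure of a completion and its endomorphisms -/

namespace IsMaltsevCompletion

variable {G H : Type*} [Group G] [Group H] {i : G →* H}

theorem hasUniqueRoots (h : IsMaltsevCompletion i) : HasUniqueRoots H := fun n hn =>
  Function.bijective_iff_existsUnique _ |>.2 (h.existsUnique_root n hn)

/-- Minimality as an induction principle: a property that holds on G and defines an isolated
subgroup holds everywhere. -/
theorem eq_top_of_isIsolated (h : IsMaltsevCompletion i) {K : Subgroup H} (hK : i.range ≤ K)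
    (hiso : K.IsIsolated) : K = ⊤ :=
  h.minimal K hK fun n hn x hx =>
    let ⟨y, hy⟩ := (h.hasUniqueRoots n hn).2 x
    ⟨y, hiso n hn y (by rwa [← hy] at hx), hy⟩

theorem map_mem_center (h : IsMaltsevCompletion i) {z : G} (hz : z ∈ Subgroup.center G) :
    i z ∈ Subgroup.center H := by
  have := h.hasUniqueRoots.isMulTorsionFree
  have htop : Subgroup.centralizer {i z} = ⊤ := by
    refine h.eq_top_of_isIsolated ?_ (Subgroup.isIsolated_centralizer _)
    rintro _ ⟨g, rfl⟩
    rw [Subgroup.mem_centralizer_singleton_iff, ← map_mul, ← map_mul, Subgroup.mem_center_iff.1 hz]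
  rw [Subgroup.mem_center_iff]
  intro x
  have hx : x ∈ Subgroup.centralizer {i z} := htop ▸ Subgroup.mem_top x
  exact Subgroup.mem_centralizer_singleton_iff.1 hx

theorem commutator_mem_center (h : IsMaltsevCompletion i)
    (hc : ∀ x y : G, ⁅x, y⁆ ∈ Subgroup.center G) (x y : H) : ⁅x, y⁆ ∈ Subgroup.center H := by
  have := h.hasUniqueRoots.quotient_center.isMulTorsionFree
  let π := QuotientGroup.mk' (Subgroup.center H)
  -- Centralizers in the torsion-free quotient by the centre are isolated, so the second commutator
  -- entry may run over `G` only. Applied twice, this extends one entry at a time.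
  have key : ∀ S : Set H, (∀ g, ∀ s ∈ S, ⁅s, i g⁆ ∈ Subgroup.center H) →
      ∀ y, ∀ s ∈ S, ⁅s, y⁆ ∈ Subgroup.center H := by
    intro S hS y s hs
    have hmem : ∀ y, (π y ∈ Subgroup.centralizer (π '' S) ↔
        ∀ s ∈ S, ⁅s, y⁆ ∈ Subgroup.center H) := fun y => by
      rw [Subgroup.mem_centralizer_iff, Set.forall_mem_image]
      refine forall₂_congr fun s _ => ?_
      rw [← commutatorElement_eq_one_iff_mul_comm, ← map_commutatorElement]
      exact QuotientGroup.eq_one_iff _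
    have htop : (Subgroup.centralizer (π '' S)).comap π = ⊤ := by
      refine h.eq_top_of_isIsolated ?_ ((Subgroup.isIsolated_centralizer _).comap π)
      rintro _ ⟨g, rfl⟩
      exact (hmem _).2 (hS g)
    have hy : y ∈ (Subgroup.centralizer (π '' S)).comap π := htop ▸ Subgroup.mem_top y
    exact (hmem y).1 hy s hs
  have h1 : ∀ y g, ⁅i g, y⁆ ∈ Subgroup.center H := fun y g => by
    refine key (Set.range i) ?_ y _ ⟨g, rfl⟩
    rintro g _ ⟨g', rfl⟩
    rw [← map_commutatorElement]
    exact h.map_mem_center (hc _ _)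
  refine key Set.univ (fun g s _ => ?_) y x trivial
  rw [← commutatorElement_inv]
  exact inv_mem (h1 s g)

theorem exists_pow_mem_range (h : IsMaltsevCompletion i)
    (hc : ∀ x y : G, ⁅x, y⁆ ∈ Subgroup.center G) (x : H) : ∃ n : ℕ, n ≠ 0 ∧ x ^ n ∈ i.range := by
  have hcH := h.commutator_mem_center hc
  let K : Subgroup H :=
    { carrier := {x | ∃ n : ℕ, n ≠ 0 ∧ x ^ n ∈ i.range}
      one_mem' := ⟨1, one_ne_zero, by simp⟩
      inv_mem' := by
        rintro x ⟨n, hn, hx⟩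
        exact ⟨n, hn, by simpa using hx⟩
      mul_mem' := by
        rintro x y ⟨a, ha, hx⟩ ⟨b, hb, hy⟩
        -- The exponent is divisible by a and b, and its binomial coefficient by ab, so the
        -- commutator correction is a power of [x^a, y^b] = [x,y]^(ab).
        have hx' : x ^ (2 * (a * b) ^ 2) ∈ i.range := by
          rw [show 2 * (a * b) ^ 2 = a * (2 * a * b ^ 2) by ring, pow_mul]
          exact pow_mem hx _
        have hy' : y ^ (2 * (a * b) ^ 2) ∈ i.range := by
          rw [show 2 * (a * b) ^ 2 = b * (2 * b * a ^ 2) by ring, pow_mul]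
          exact pow_mem hy _
        have hxy : ⁅x, y⁆ ^ (2 * (a * b) ^ 2).choose 2 ∈ i.range := by
          have hcomm : ⁅x ^ a, y ^ b⁆ = ⁅x, y⁆ ^ (a * b) := by
            have e : commutatorHom hcH (x ^ a) (y ^ b) = commutatorHom hcH x y ^ (a * b) := by
              rw [map_pow, map_pow, pow_mul]; rfl
            exact congrArg Subtype.val e
          have hch : (2 * (a * b) ^ 2).choose 2 = a * b * (a * b * (2 * (a * b) ^ 2 - 1)) := by
            rw [Nat.choose_two_right, mul_assoc 2, Nat.mul_div_cancel_left _ two_pos]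
            ring
          rw [hch, pow_mul, ← hcomm]
          obtain ⟨g, hg⟩ := hx
          obtain ⟨g', hg'⟩ := hy
          rw [← hg, ← hg', ← map_commutatorElement]
          exact pow_mem (MonoidHom.mem_range.2 ⟨_, rfl⟩) _
        refine ⟨2 * (a * b) ^ 2, by positivity, ?_⟩
        rw [← Subgroup.mul_mem_cancel_right _ hxy, mul_pow_of_commutator_mem_center hcH]
        exact mul_mem hx' hy' }
  have hK : K = ⊤ := by
    refine h.eq_top_of_isIsolated ?_ ?_
    · rintro x hx
      exact ⟨1, one_ne_zero, by simpa using hx⟩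
    · rintro n hn x ⟨m, hm, hx⟩
      exact ⟨n * m, mul_ne_zero hn hm, by rwa [pow_mul]⟩
  exact (hK ▸ Subgroup.mem_top x : x ∈ K)

theorem exists_pow_mem_range_of_finite (h : IsMaltsevCompletion i)
    (hc : ∀ x y : G, ⁅x, y⁆ ∈ Subgroup.center G) {S : Set H} (hS : S.Finite) :
    ∃ n : ℕ, n ≠ 0 ∧ ∀ x ∈ S, x ^ n ∈ i.range := by
  induction S, hS using Set.Finite.induction_on with
  | empty => exact ⟨1, one_ne_zero, by simp⟩
  | @insert a S _ _ ih =>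
    obtain ⟨n, hn, hS⟩ := ih
    obtain ⟨m, hm, ha⟩ := h.exists_pow_mem_range hc a
    refine ⟨n * m, mul_ne_zero hn hm, ?_⟩
    rintro x (rfl | hx)
    · rw [mul_comm, pow_mul]
      exact pow_mem ha _
    · rw [pow_mul]
      exact pow_mem (hS x hx) _

/-- Every finite subset of the completion is moved into the group by an injective endomorphism of
the completion. -/
theorem exists_injective_endomorphism (h : IsMaltsevCompletion i)
    (hc : ∀ x y : G, ⁅x, y⁆ ∈ Subgroup.center G) {S : Set H} (hS : S.Finite) :
    ∃ φ : H →* H, Function.Injective φ ∧ ∀ x ∈ S, φ x ∈ i.range := by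
  have hcH := h.commutator_mem_center hc
  have hroots := h.hasUniqueRoots
  have := hroots.isMulTorsionFree
  obtain ⟨q, hq, hqz⟩ := exists_quadratic_map hcH (D := Subgroup.center H) (fun n hn z => by
    obtain ⟨y, hy : y ^ n = z⟩ := (hroots n hn).2 z
    exact ⟨⟨y, Subgroup.isIsolated_center n hn y (hy ▸ z.2)⟩, Subtype.ext hy⟩) (MonoidHom.id _)
  -- One m serves both `S` and `q(S)`. The exponent below is 2m because m divides (2m choose 2).
  obtain ⟨m, hm, hmS⟩ := h.exists_pow_mem_range_of_finite hc
    (hS.union (hS.image fun x => (q x : H)))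
  let φ : H →* H := MonoidHom.mk' (fun x => x ^ (2 * m) * (q x : H) ^ (2 * m).choose 2)
    fun x y => by
      have hz : ∀ (x w : H) (k : ℕ), Commute ((q x : H) ^ k) w := fun x w k =>
        Commute.pow_left (Subgroup.mem_center_iff.1 (q x).2 w).symm k
      have hqxy : (q (x * y) : H) = q x * q y * ⁅x, y⁆ := congrArg Subtype.val (hq x y)
      have hcz : Commute ((q x : H) * q y) ⁅x, y⁆ := Subgroup.mem_center_iff.1 (hcH x y) _
      have hqq : Commute (q x : H) (q y) := Subgroup.mem_center_iff.1 (q y).2 _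
      rw [hqxy, hcz.mul_pow, hqq.mul_pow, (((hz x _ _).mul_left (hz y _ _)).eq), ← mul_assoc,
        mul_pow_of_commutator_mem_center hcH, mul_assoc, mul_assoc, ← mul_assoc (y ^ _),
        ← (hz x _ _).eq]
      simp only [mul_assoc]
  refine ⟨φ, ?_, fun x hx => ?_⟩
  · rw [injective_iff_map_eq_one]
    intro x hx
    have hx' : x ^ (2 * m) * (q x : H) ^ (2 * m).choose 2 = 1 := hx
    -- A kernel element has a central power, hence is central; there φ is a nonzero power map.
    have hxc : x ∈ Subgroup.center H := by
      refine Subgroup.isIsolated_center (2 * m) (by positivity) x ?_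
      rw [eq_inv_of_mul_eq_one_left hx']
      exact inv_mem (pow_mem (q x).2 _)
    have hqx : (q x : H) = x ^ 2 := congrArg Subtype.val (hqz ⟨x, hxc⟩)
    rw [hqx, ← pow_mul, ← pow_add] at hx'
    exact pow_left_injective (n := 2 * m + 2 * (2 * m).choose 2) (by positivity)
      (by simpa using hx')
  · have h2 : (2 * m).choose 2 = m * (2 * m - 1) := by
      rw [Nat.choose_two_right, mul_assoc 2, Nat.mul_div_cancel_left _ two_pos]
    change x ^ (2 * m) * (q x : H) ^ (2 * m).choose 2 ∈ i.range
    rw [h2, pow_mul (q x : H), mul_comm 2, pow_mul]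
    exact mul_mem (pow_mem (hmS x (Or.inl hx)) _) (pow_mem (hmS _ (Or.inr ⟨x, hx, rfl⟩)) _)

end IsMaltsevCompletion

/-! ### Transfer of words, laws and closures -/

theorem FreeGroup.exists_finite_support {X : Type*} (w : FreeGroup X) :
    ∃ S : Set X, S.Finite ∧ ∀ {K : Type u} [Group K] (f g : FreeGroup X →* K),
      (∀ x ∈ S, f (FreeGroup.of x) = g (FreeGroup.of x)) → f w = g w := by
  induction w using FreeGroup.induction_on with
  | C1 => exact ⟨∅, Set.finite_empty, fun f g _ => by simp⟩
  | of x => exact ⟨{x}, Set.finite_singleton x, fun f g h => h x rfl⟩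
  | inv_of x ih => exact ⟨{x}, Set.finite_singleton x, fun f g h => by simp [h x rfl]⟩
  | mul x y hx hy =>
    obtain ⟨S, hS, hSx⟩ := hx
    obtain ⟨S', hS', hSy⟩ := hy
    refine ⟨S ∪ S', hS.union hS', fun f g h => ?_⟩
    rw [_root_.map_mul, _root_.map_mul, hSx f g fun x hx => h x (Or.inl hx), hSy f g fun x hx => h x (Or.inr hx)]

namespace IsMaltsevCompletion

/-- A homomorphism from a free group to the completion can be replaced by one to the group which
annihilates the same elements of a given finite set of words. -/
theorem exists_hom_eq_one_iff {G : Type u} {H : Type v} [Group G] [Group H] {i : G →* H}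
    (h : IsMaltsevCompletion i) (hc : ∀ x y : G, ⁅x, y⁆ ∈ Subgroup.center G) {X : Type*}
    (T : Finset (FreeGroup X)) (f : FreeGroup X →* H) :
    ∃ g : FreeGroup X →* G, ∀ t ∈ T, (g t = 1 ↔ f t = 1) := by
  classical
  choose S hS hSw using fun w : FreeGroup X => FreeGroup.exists_finite_support.{v} w
  have hfin : (⋃ t ∈ T, S t).Finite := T.finite_toSet.biUnion fun t _ => hS t
  obtain ⟨φ, hφ, hφS⟩ := h.exists_injective_endomorphism hc
    (hfin.image fun x => f (FreeGroup.of x))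
  choose! r hr using hφS
  -- Variables outside the finite support get arbitrary values, since `r` is only controlled on that
  -- support.
  refine ⟨FreeGroup.lift fun x => r (f (FreeGroup.of x)), fun t ht => ?_⟩
  rw [← h.injective.eq_iff, map_one, ← hφ.eq_iff (a := f t), map_one]
  have := hSw t (i.comp (FreeGroup.lift fun x => r (f (FreeGroup.of x)))) (φ.comp f)
    fun x hx => by
      simpa using hr _ ⟨x, Set.mem_biUnion ht hx, rfl⟩
  rw [MonoidHom.comp_apply, MonoidHom.comp_apply] at this
  rw [this]

theorem contains {G : Type u} {H : Type v} [Group G] [Group H] {i : G →* H}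
    (h : IsMaltsevCompletion i) (hc : ∀ x y : G, ⁅x, y⁆ ∈ Subgroup.center G) {Θ : GroupVariety}
    (hG : Θ.Contains G) : Θ.Contains H := by
  intro w hw f
  obtain ⟨g, hg⟩ := h.exists_hom_eq_one_iff hc {w} f
  exact (hg w (Finset.mem_singleton_self w)).1 (hG w hw g)

theorem sameQuasiIdentities {G : Type u} {H : Type v} [Group G] [Group H] {i : G →* H}
    (h : IsMaltsevCompletion i) (hc : ∀ x y : G, ⁅x, y⁆ ∈ Subgroup.center G) :
    SameQuasiIdentities G H := by
  classical
  refine fun T w => ⟨fun hG f hf => ?_, fun hH f hf => ?_⟩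
  · obtain ⟨g, hg⟩ := h.exists_hom_eq_one_iff hc (insert w T) f
    exact (hg w (T.mem_insert_self w)).1 (hG g fun t ht =>
      (hg t (Finset.mem_insert_of_mem ht)).2 (hf t ht))
  · exact h.injective ((hH (i.comp f) fun t ht => by simp [hf t ht]).trans (map_one i).symm)

theorem xEquivalent {G : Type u} {H : Type v} [Group G] [Group H] {i : G →* H}
    (h : IsMaltsevCompletion i) (hc : ∀ x y : G, ⁅x, y⁆ ∈ Subgroup.center G) (Θ : GroupVariety)
    (X : Type) [Finite X] : Θ.XEquivalent X G H := by
  intro T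
  ext w
  simp only [GroupVariety.geomClosure, GroupVariety.algVariety, Set.mem_iInter, Set.mem_ofPred_eq]
  refine ⟨fun hw μ hμ => ?_, fun hw μ hμ => ?_⟩
  · let ξ : X → Θ.W X := fun x => QuotientGroup.mk (FreeGroup.of x)
    obtain ⟨φ, hφ, hφr⟩ := h.exists_injective_endomorphism hc (Set.finite_range (μ ∘ ξ))
    have hmem : ∀ v, φ (μ v) ∈ i.range := by
      rintro ⟨v⟩
      change ((φ.comp μ).comp (QuotientGroup.mk' (Θ.verbalSubgroup X))) v ∈ i.range
      induction v using FreeGroup.induction_on with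
      | C1 => rw [map_one]; exact one_mem _
      | of x => exact hφr _ ⟨x, rfl⟩
      | inv_of x ih => rw [map_inv]; exact inv_mem ih
      | mul x y hx hy => rw [map_mul]; exact mul_mem hx hy
    let ν : Θ.W X →* G := (MonoidHom.ofInjective h.injective).symm.toMonoidHom.comp
      ((φ.comp μ).codRestrict i.range hmem)
    have hν : ∀ v, v ∈ ν.ker ↔ v ∈ μ.ker := fun v => by
      rw [MonoidHom.mem_ker, MonoidHom.mem_ker, ← hφ.eq_iff, map_one]
      change (MonoidHom.ofInjective h.injective).symm _ = 1 ↔ _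
      rw [MulEquiv.map_eq_one_iff]
      exact Subtype.ext_iff
    exact (hν w).1 (hw ν fun t ht => (hν t).2 (hμ ht))
  · have hker : ∀ v, v ∈ (i.comp μ).ker ↔ v ∈ μ.ker := fun v => by
      rw [MonoidHom.mem_ker, MonoidHom.mem_ker, MonoidHom.comp_apply,
        map_eq_one_iff i h.injective]
    exact (hker w).1 (hw (i.comp μ) fun t ht => (hker t).2 (hμ ht))

end IsMaltsevCompletion

theorem commutator_mem_center_of_nilpotencyClass_le_two {G : Type*} [Group G]
    [Group.IsNilpotent G] (hclass : Group.nilpotencyClass G ≤ 2) (x y : G) :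
    ⁅x, y⁆ ∈ Subgroup.center G := by
  have htop := Subgroup.upperCentralSeries_eq_top_iff_nilpotencyClass_le.2 hclass
  rw [← Subgroup.upperCentralSeries_one]
  exact (Subgroup.mem_upperCentralSeries_succ_iff.1 (htop ▸ Subgroup.mem_top x)) y

/-- If x^n = y^n then [x,y]^n = [x,y^n] = [x,x^n] = 1, so x and y commute and (xy⁻¹)^n = 1. -/
theorem isMulTorsionFree_of_commutator_mem_center {G : Type*} [Group G]
    (hc : ∀ x y : G, ⁅x, y⁆ ∈ Subgroup.center G) (htf : ∀ g : G, IsOfFinOrder g → g = 1) :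
    IsMulTorsionFree G := by
  have hroot : ∀ (n : ℕ) (z : G), n ≠ 0 → z ^ n = 1 → z = 1 := fun n z hn hz =>
    htf z (isOfFinOrder_iff_pow_eq_one.2 ⟨n, Nat.pos_of_ne_zero hn, hz⟩)
  refine ⟨fun n hn x y (hxy : x ^ n = y ^ n) => ?_⟩
  have hcomm : Commute x y := by
    refine commutatorElement_eq_one_iff_mul_comm.1 (hroot n _ hn ?_)
    have e : commutatorHom hc x y ^ n = commutatorHom hc x (y ^ n) := (map_pow _ _ _).symm
    have e' : (⁅x, y⁆ : G) ^ n = ⁅x, y ^ n⁆ := congrArg Subtype.val e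
    rw [e', ← hxy, commutatorElement_eq_one_iff_mul_comm, (Commute.self_pow x n).eq]
  exact mul_inv_eq_one.1 (hroot n _ hn (by
    rw [hcomm.inv_right.mul_pow, hxy, inv_pow, mul_inv_cancel]))

theorem theorem1 {G : Type u} [Group G] [Group.IsNilpotent G]
    (hclass : Group.nilpotencyClass G ≤ 2)
    (htf : ∀ g : G, IsOfFinOrder g → g = 1) :
    (∃ (H : Type u) (_ : Group H) (i : G →* H), IsMaltsevCompletion i) ∧
    ∀ (H : Type v) [Group H] (i : G →* H), IsMaltsevCompletion i →
      (∀ Θ : GroupVariety, Θ.Contains G → Θ.GeomEquivalent G H) ∧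
      SameQuasiIdentities G H := by
  have hc := commutator_mem_center_of_nilpotencyClass_le_two hclass
  have := isMulTorsionFree_of_commutator_mem_center hc htf
  refine ⟨?_, fun H _ i h => ⟨fun Θ hG => ?_, h.sameQuasiIdentities hc⟩⟩
  · obtain ⟨H, _, f, hH, hf⟩ := exists_injective_hom_hasUniqueRoots hc
    exact hH.exists_isMaltsevCompletion f hf
  · exact ⟨hG, h.contains hc hG, fun X _ => h.xEquivalent hc Θ X⟩
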